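/- **Curves.** An oriented base $X^\theta$ consists of a type $X\in\{I,R,L,U,B,D,P,Q,C\}$ and a counterclockwise rotation $\theta\in\{0,90,180,270\}$ (mod 360; $\theta=0$ is omitted). It stands for a grid point together with an entry and an exit direction; for $\theta=0$: $I$ enters from the bottom and leaves at the top, $R$ bottom-in right-out, $L$ bottom-in left-out, $U$ bottom-in bottom-out, $B$ and $D$ entry-closed and top-out, $P$ and $Q$ bottom-in and exit-closed, $C$ closed at both ends. Each base has two level-1 expansions $X_1,X_2$ (codes 1 and 2): $$\begin{aligned} I_1&=RL^{270}LR^{90}, & I_2&=LR^{90}RL^{270}, & R_1&=IRR^{270}L^{180}, & R_2&=LR^{90}RI^{270},\\ L_1&=RL^{270}LI^{90}, & L_2&=ILL^{90}R^{180}, & U_1&=IRR^{270}I^{180}, & U_2&=ILL^{90}I^{180},\\ B_1&=L^{180}L^{270}LR^{90}, & B_2&=R^{180}R^{90}RL^{270}, & D_1&=R^{270}R^{180}R^{90}I, & D_2&=L^{90}L^{180}L^{270}I,\\ P_1&=RL^{270}LL^{90}, & P_2&=LR^{90}RR^{270}, & Q_1&=IRR^{270}R^{180}, & Q_2&=ILL^{90}L^{180},\\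 C_1&=R^{90}RR^{270}R^{180}, & C_2&=L^{270}LL^{90}L^{180}, \end{aligned}$$ and $X^\theta$ expands with code $\pi$ to $X_\pi$ with all four rotations increased by $\theta$. A sequence $X_1^{\theta_1}\cdots X_n^{\theta_n}$ is expanded to the next level by choosing a code $\pi_1\in\{1,2\}$ for its first base, giving $X_{i+1}^{\theta_{i+1}}$ the same code as $X_i^{\theta_i}$ if $\theta_i\equiv\theta_{i+1}\pmod{180}$ and the other code otherwise, and replacing every base by its expansion. A level-$k$ curve ($k\ge 0$) is a sequence of $4^k$ oriented bases obtained from a single oriented base by $k$ successive expansions, with arbitrary choices of the first code at each level. Its path is the sequence of $4^k$ points of $\mathbb Z^2$ obtained by moving one unit from each base to the next in the exit direction of the base. **Shapes.** Two level-$k$ curves have the same shape if, ignoring entry and exit directions, some combination of rotations (by multiples of 90 degrees), reflections and reversal (and translation) makes their paths overlap completely. A curve of level $k\ge 2$ is *corner-induced* if its entry point (the first point of the path) is a corner of the square formed by its first subunit, i.e. by the first $4^{k-1}$ points; otherwise it is *side-induced*. **Statement.** For $k\in\{0,1\}$ all level-$k$ curves have the same shape, so there is exactly 1 shape. For every $k\ge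 2$ the number of distinct shapes of level-$k$ curves is $$6+6\,(2^{k-1}-2)=6\cdot 2^{k-1}-6 .$$ More precisely, for $k\ge2$ no corner-induced curve has the same shape as a side-induced curve, the corner-induced curves have exactly $6$ distinct shapes, and the side-induced curves have exactly $6\,(2^{k-1}-2)$ distinct shapes. -/

import Mathlib

namespace TwoByTwo

/-- The nine base patterns (level-0 units): points with an entry and an exit direction.
In base rotation state: `I` bottom-in top-out, `R` bottom-in right-out, `L` bottom-in left-out,
`U` bottom-in bottom-out, `B`, `D` entry-closed top-out, `P`, `Q` bottom-in exit-closed,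
`C` entry-closed and exit-closed. -/
inductive Base
  | I | R | L | U | B | D | P | Q | C
  deriving DecidableEq

/-- A base `X^θ` with its counterclockwise rotation `θ`, in units of 90 degrees. -/
structure OBase where
  base : Base
  rot : ZMod 4
  deriving DecidableEq

/-- Expansion codes 1 and 2. -/
inductive Code
  | one | two
  deriving DecidableEq

/-- The complement of a code. -/
def Code.compl : Code → Code
  | .one => .two
  | .two => .one

/-- The expansion rules from level 0 to level 1 in base rotation state.
Rotations `1, 2, 3` stand for 90, 180, 270 degrees. -/
def Base.unit : Base → Code → List OBase
  | .I, .one => [⟨.R, 0⟩, ⟨.L, 3⟩, ⟨.L, 0⟩, ⟨.R, 1⟩]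
  | .I, .two => [⟨.L, 0⟩, ⟨.R, 1⟩, ⟨.R, 0⟩, ⟨.L, 3⟩]
  | .R, .one => [⟨.I, 0⟩, ⟨.R, 0⟩, ⟨.R, 3⟩, ⟨.L, 2⟩]
  | .R, .two => [⟨.L, 0⟩, ⟨.R, 1⟩, ⟨.R, 0⟩, ⟨.I, 3⟩]
  | .L, .one => [⟨.R, 0⟩, ⟨.L, 3⟩, ⟨.L, 0⟩, ⟨.I, 1⟩]
  | .L, .two => [⟨.I, 0⟩, ⟨.L, 0⟩, ⟨.L, 1⟩, ⟨.R, 2⟩]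
  | .U, .one => [⟨.I, 0⟩, ⟨.R, 0⟩, ⟨.R, 3⟩, ⟨.I, 2⟩]
  | .U, .two => [⟨.I, 0⟩, ⟨.L, 0⟩, ⟨.L, 1⟩, ⟨.I, 2⟩]
  | .B, .one => [⟨.L, 2⟩, ⟨.L, 3⟩, ⟨.L, 0⟩, ⟨.R, 1⟩]
  | .B, .two => [⟨.R, 2⟩, ⟨.R, 1⟩, ⟨.R, 0⟩, ⟨.L, 3⟩]
  | .D, .one => [⟨.R, 3⟩, ⟨.R, 2⟩, ⟨.R, 1⟩, ⟨.I, 0⟩]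
  | .D, .two => [⟨.L, 1⟩, ⟨.L, 2⟩, ⟨.L, 3⟩, ⟨.I, 0⟩]
  | .P, .one => [⟨.R, 0⟩, ⟨.L, 3⟩, ⟨.L, 0⟩, ⟨.L, 1⟩]
  | .P, .two => [⟨.L, 0⟩, ⟨.R, 1⟩, ⟨.R, 0⟩, ⟨.R, 3⟩]
  | .Q, .one => [⟨.I, 0⟩, ⟨.R, 0⟩, ⟨.R, 3⟩, ⟨.R, 2⟩]
  | .Q, .two => [⟨.I, 0⟩, ⟨.L, 0⟩, ⟨.L, 1⟩, ⟨.L, 2⟩]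
  | .C, .one => [⟨.R, 1⟩, ⟨.R, 0⟩, ⟨.R, 3⟩, ⟨.R, 2⟩]
  | .C, .two => [⟨.L, 3⟩, ⟨.L, 0⟩, ⟨.L, 1⟩, ⟨.L, 2⟩]

/-- The level-1 unit of `X^θ` of type `c`: expand `X`, then rotate every base by `θ`. -/
def OBase.unit (x : OBase) (c : Code) : List OBase :=
  (x.base.unit c).map fun z => ⟨z.base, z.rot + x.rot⟩

/-- Expansion of a base sequence to the next level, `c` being the code of its first base.
From one base to the next the code is kept if the two rotations agree modulo 180 degrees, and
complemented otherwise; this is what makes neighbouring units connect properly. -/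
def expand : Code → List OBase → List OBase
  | _, [] => []
  | c, [x] => x.unit c
  | c, x :: y :: s =>
      x.unit c ++ expand (if 2 * (x.rot - y.rot) = 0 then c else c.compl) (y :: s)

/-- The curve `X^θ|π₁…πₖ`, as a base sequence. -/
def encoded (x : OBase) (codes : List Code) : List OBase :=
  codes.foldl (fun s c => expand c s) [x]

/-- The level-`k` curves initialized from a single base. -/
def Curve (k : ℕ) : Type :=
  {s : List OBase // ∃ (x : OBase) (codes : List Code), codes.length = k ∧ encoded x codes = s}

/-- Counterclockwise rotation of the plane by 90 degrees about the origin. -/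
def rot90 : Equiv.Perm (ℤ × ℤ) where
  toFun p := (-p.2, p.1)
  invFun p := (p.2, -p.1)
  left_inv p := by simp
  right_inv p := by simp

/-- Horizontal reflection of the plane. -/
def hrefl : Equiv.Perm (ℤ × ℤ) where
  toFun p := (-p.1, p.2)
  invFun p := (-p.1, p.2)
  left_inv p := by simp
  right_inv p := by simp

/-- The offset from a base in base rotation state to the next base, read off its exit direction.
The exit-closed bases `P`, `Q`, `C` never have a successor; their value is not used. -/
def Base.step : Base → ℤ × ℤ
  | .I | .B | .D => (0, 1)
  | .R => (1, 0)
  | .L => (-1, 0)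
  | .U => (0, -1)
  | .P | .Q | .C => (0, 0)

/-- The offset from `X^θ` to the next base. -/
def OBase.step (x : OBase) : ℤ × ℤ := (rot90 ^ x.rot.val) x.base.step

/-- The points visited by a base sequence whose first base is located at `p`. The directions in
which the first point is entered and the last point is left play no role here. -/
def pointsFrom : ℤ × ℤ → List OBase → List (ℤ × ℤ)
  | _, [] => []
  | p, x :: s => p :: pointsFrom (p + x.step) s

/-- The path of a curve, without its entry and exit directions, starting at the origin. -/
def Curve.path {k : ℕ} (P : Curve k) : List (ℤ × ℤ) := pointsFrom 0 P.1

/-- All combinations of rotations and reflections of the grid, and of translations (the position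
at which a curve is drawn is irrelevant). -/
def planeMoves : Subgroup (Equiv.Perm (ℤ × ℤ)) :=
  Subgroup.closure ({rot90, hrefl} ∪ Set.range fun v : ℤ × ℤ => Equiv.addLeft v)

/-- Two curves have the same shape if a combination of rotation, reflection and reversal makes
their paths overlap completely. -/
def SameShape {k : ℕ} (P Q : Curve k) : Prop :=
  ∃ f ∈ planeMoves, Q.path = P.path.map f ∨ Q.path = (P.path.map f).reverse

theorem sameShape_equivalence (k : ℕ) : Equivalence (SameShape (k := k)) where
  refl P := ⟨1, one_mem _, Or.inl (by simp)⟩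
  symm := by
    rintro P Q ⟨f, hf, h⟩
    have key : ∀ l : List (ℤ × ℤ), (l.map f).map (f⁻¹ : Equiv.Perm (ℤ × ℤ)) = l := by
      intro l; simp [List.map_map, Function.comp_def]
    refine ⟨f⁻¹, inv_mem hf, ?_⟩
    rcases h with h | h
    · left; rw [h, key]
    · right; rw [h, List.map_reverse, key, List.reverse_reverse]
  trans := by
    rintro P Q S ⟨f, hf, h⟩ ⟨g, hg, h'⟩
    have key : ∀ l : List (ℤ × ℤ), (l.map f).map g = l.map (g * f : Equiv.Perm (ℤ × ℤ)) := by
      intro l; simp [List.map_map, Function.comp_def]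
    refine ⟨g * f, mul_mem hg hf, ?_⟩
    rcases h with h | h <;> rcases h' with h' | h' <;> rw [h', h]
    · left; rw [key]
    · right; rw [key]
    · right; rw [List.map_reverse, key]
    · left; rw [List.map_reverse, key, List.reverse_reverse]

/-- Having the same shape, as a setoid on the level-`k` curves. -/
def shapeSetoid (k : ℕ) : Setoid (Curve k) := ⟨SameShape, sameShape_equivalence k⟩

/-- The shapes of level-`k` curves. -/
def Shape (k : ℕ) : Type := Quotient (shapeSetoid k)

/-- The shape of a curve. -/
def Curve.shape {k : ℕ} (P : Curve k) : Shape k := Quotient.mk (shapeSetoid k) P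

/-- `p` is a corner of the square filled by the points in `S`: both of its coordinates are
extreme. -/
def IsCornerOf (p : ℤ × ℤ) (S : List (ℤ × ℤ)) : Prop :=
  ((∀ q ∈ S, p.1 ≤ q.1) ∨ (∀ q ∈ S, q.1 ≤ p.1)) ∧ ((∀ q ∈ S, p.2 ≤ q.2) ∨ (∀ q ∈ S, q.2 ≤ p.2))

/-- A curve of level `k ≥ 1` is corner-induced if its entry point is a corner of its first
subunit, that is, of the square filled by its first `4 ^ (k - 1)` points. -/
def Curve.CornerInduced {k : ℕ} (P : Curve k) : Prop :=
  ∃ p, P.path.head? = some p ∧ IsCornerOf p (P.path.take (4 ^ (k - 1)))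

/-- A curve is side-induced if it is not corner-induced. -/
def Curve.SideInduced {k : ℕ} (P : Curve k) : Prop := ¬ P.CornerInduced

/-- The shapes of corner-induced curves. -/
def cornerShapes (k : ℕ) : Set (Shape k) := {S | ∃ P : Curve k, P.CornerInduced ∧ P.shape = S}

/-- The shapes of side-induced curves. -/
def sideShapes (k : ℕ) : Set (Shape k) := {S | ∃ P : Curve k, P.SideInduced ∧ P.shape = S}

end TwoByTwo

/-!
Let `absUnit a x` be the unit of `x` whose code is `a` if the rotation of `x` is even and the
complement of `a` otherwise. Expanding a sequence replaces every base `x` by `absUnit a x` with one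
and the same `a` (`expand_cons`), so a level-`k` curve is obtained from a single base by `k`
substitutions, one for each entry of a list of absolute codes (`iterUnit`). Rotations and
reflections act on bases and commute with the substitutions up to complementing codes
(`absUnit_moveTile`). A reflection composed with reversal commutes with them on the nose
(`absUnit_revRefl`).

Every level-1 curve is, up to a rotation and a reflection, one of the nine curves `stdU e f` that go
up, right, down, where `e` and `f` record the three sides from which the first point can be entered
and the three sides towards which the last point can be left. Hence every curve of level `n + 1` is
a moved `stdCurve e f a` with a list `a` of `n` codes (`exists_stdCurve`), and exchanging `e` and
`f` does not change the shape (`sameShape_swap`).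

It remains to see when two standard curves have the same shape. Every fourth step of an expanded
sequence is a step of the original one, so the path determines the paths of all coarser levels
(`steps_of_steps_iterUnit`). In particular a plane move that maps one standard path to another
fixes the steps up and right, thus all steps, and the codes can be read off
(`eq_of_dirs_eq_map`). The entry side `e` is visible in the path unless, at every level, the two
candidates for the first base expand to units with the same steps. This happens only if all codes
coincide: with all codes 1 the entries from the bottom and from the left are merged, with all codes
2 the entries from the bottom and from the right (`steps_startTile_eq_iff`). The shapes thus
correspond to lists of codes together with an unordered pair of entry classes: there are 2 constant
lists with 2 classes each, giving `2 * 3` shapes, and `2 ^ n - 2` other lists with 3 classes each,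
giving `6` shapes per list (`sameShape_iff`, `ncard_cornerShapes`, `ncard_sideShapes`).

Finally, the points of an expanded base fill a square, and the entry point lies on the entry side at
the position whose binary digits are the codes (`entryPt`, `mem_points_iterUnit`). It is a corner
exactly if the codes are constant (`isCornerOf_points_iff`).
-/

namespace TwoByTwo

/-! ### Absolute codes and symmetries of the units -/

instance : Fintype Base where
  elems := {.I, .R, .L, .U, .B, .D, .P, .Q, .C}
  complete x := by cases x <;> decide

instance : Fintype Code where
  elems := {.one, .two}
  complete x := by cases x <;> decide

/-- An oriented base as a pair of a base and a rotation. -/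
def OBase.equivProd : Base × ZMod 4 ≃ OBase where
  toFun p := ⟨p.1, p.2⟩
  invFun x := (x.base, x.rot)
  left_inv _ := rfl
  right_inv _ := rfl

instance : Fintype OBase := Fintype.ofEquiv _ OBase.equivProd

/-- Conversion between the code of a base of rotation `r` and its absolute code: they agree if `r`
is even and are complementary otherwise. -/
def absCode (r : ZMod 4) (c : Code) : Code := if 2 * r = 0 then c else c.compl

/-- The unit of `x` of absolute code `a`. -/
def absUnit (a : Code) (x : OBase) : List OBase := x.unit (absCode x.rot a)

/-- Successive substitution of every base by its unit, the absolute codes being the entries of `a`.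
The head of `a` is used first, that is, at the coarsest level. -/
def iterUnit (a : List Code) (s : List OBase) : List OBase :=
  a.foldl (fun s c => s.flatMap (absUnit c)) s

theorem absCode_absCode : ∀ (r : ZMod 4) (c : Code), absCode r (absCode r c) = c := by
  decide +kernel

theorem absCode_step : ∀ (r t : ZMod 4) (c : Code),
    absCode t (if 2 * (r - t) = 0 then c else c.compl) = absCode r c := by
  decide +kernel

/-- Expansion replaces every base by its unit of one common absolute code. -/
theorem expand_cons (x : OBase) (s : List OBase) (c : Code) :
    expand c (x :: s) = (x :: s).flatMap (absUnit (absCode x.rot c)) := by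
  induction s generalizing x c with
  | nil => simp [expand, absUnit, absCode_absCode]
  | cons y s ih =>
    rw [expand, ih, absCode_step, List.flatMap_cons (x := x), absUnit, absCode_absCode]

/-- The bases occurring in units. They have an open entry and an open exit on different sides. -/
def OBase.IsOpen (x : OBase) : Prop := x.base = .I ∨ x.base = .R ∨ x.base = .L

instance (x : OBase) : Decidable x.IsOpen := inferInstanceAs (Decidable (_ ∨ _))

/-- The rotation of the direction in which an open base is left, the upward direction having
rotation `0`. An open base is entered in the direction of rotation `x.rot`. -/
def OBase.exitRot (x : OBase) : ZMod 4 :=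
  match x.base with
  | .R => x.rot + 3
  | .L => x.rot + 1
  | _ => x.rot

/-- The base `y` is entered in the direction in which `x` is left. -/
def Joins (x y : OBase) : Prop := y.rot = x.exitRot

instance (x y : OBase) : Decidable (Joins x y) := inferInstanceAs (Decidable (_ = _))

/-- The open base traversed backwards and reflected horizontally. On the remaining bases the value
is irrelevant. -/
def revRefl (x : OBase) : OBase :=
  match x.base with
  | .I => ⟨.I, 2 - x.rot⟩
  | .R => ⟨.R, 3 - x.rot⟩
  | .L => ⟨.L, 1 - x.rot⟩
  | _ => x

theorem absUnit_revRefl : ∀ (c : Code) (x : OBase), x.IsOpen →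
    absUnit c (revRefl x) = ((absUnit c x).map revRefl).reverse := by
  decide +kernel

theorem absUnit_open : ∀ (c : Code) (x : OBase), ∀ y ∈ absUnit c x, y.IsOpen := by
  decide +kernel

/-- A unit is a connected path, entered and left in the same directions as its base. -/
theorem absUnit_spec : ∀ (c : Code) (x : OBase), x.IsOpen →
    (absUnit c x).length = 4 ∧ (absUnit c x).IsChain Joins ∧
    (∀ y ∈ (absUnit c x).head?, y.rot = x.rot) ∧
    (∀ y ∈ (absUnit c x).getLast?, y.exitRot = x.exitRot) := by
  decide +kernel

/-- The effect of a horizontal reflection on the base type. -/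
def reflBase : Base → Base
  | .R => .L
  | .L => .R
  | b => b

/-- The action on oriented bases of a horizontal reflection (if `b` holds) followed by `i` quarter
turns. -/
def moveTile (i : ZMod 4) (b : Bool) (x : OBase) : OBase :=
  if b then ⟨reflBase x.base, i - x.rot⟩ else ⟨x.base, i + x.rot⟩

/-- The plane move underlying `moveTile i b`. -/
def movePlane (i : ZMod 4) (b : Bool) : Equiv.Perm (ℤ × ℤ) :=
  if b then rot90 ^ i.val * hrefl else rot90 ^ i.val

/-- The effect of `moveTile i b` on absolute codes. -/
def moveCode (i : ZMod 4) (b : Bool) (c : Code) : Code :=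
  if b then (absCode i c).compl else absCode i c

theorem moveCode_moveCode : ∀ i b c, moveCode i b (moveCode i b c) = c := by decide +kernel

theorem absUnit_moveTile : ∀ i b c x,
    absUnit (moveCode i b c) (moveTile i b x) = (absUnit c x).map (moveTile i b) := by
  decide +kernel

theorem step_moveTile : ∀ i b x, (moveTile i b x).step = movePlane i b x.step := by
  decide +kernel

/-- The three open bases with upward exit, entered from the bottom, the left and the right. -/
def startTile : Fin 3 → OBase
  | 0 => ⟨.I, 0⟩
  | 1 => ⟨.L, 3⟩
  | 2 => ⟨.R, 1⟩

/-- The standard level-1 sequence: it goes up, right, down, it is entered as `startTile e`, and it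
is left in the mirror image of the way `startTile f` is entered. -/
def stdU (e f : Fin 3) : List OBase := [startTile e, ⟨.R, 0⟩, ⟨.R, 3⟩, revRefl (startTile f)]

theorem exists_stdU : ∀ c x, ∃ i b e f, absUnit c x = (stdU e f).map (moveTile i b) := by
  decide +kernel

theorem exists_absUnit_eq_stdU : ∀ e f, ∃ c x, absUnit c x = stdU e f := by
  decide +kernel

theorem iterUnit_cons (c : Code) (a : List Code) (s : List OBase) :
    iterUnit (c :: a) s = iterUnit a (s.flatMap (absUnit c)) := rfl

theorem iterUnit_append (a : List Code) (s t : List OBase) :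
    iterUnit a (s ++ t) = iterUnit a s ++ iterUnit a t := by
  induction a generalizing s t with
  | nil => rfl
  | cons c a ih => rw [iterUnit_cons, List.flatMap_append, ih]; rfl

theorem length_absUnit : ∀ (c : Code) (x : OBase), (absUnit c x).length = 4 := by decide +kernel

theorem flatMap_absUnit_ne_nil (c : Code) (x : OBase) (s : List OBase) :
    (x :: s).flatMap (absUnit c) ≠ [] := by
  intro h
  have := congrArg List.length h
  simp [length_absUnit] at this

theorem encoded_eq_iterUnit (cs : List Code) : ∀ s : List OBase, s ≠ [] →
    ∃ a : List Code, a.length = cs.length ∧ cs.foldl (fun s c => expand c s) s = iterUnit a s := by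
  induction cs with
  | nil => exact fun s _ => ⟨[], rfl, rfl⟩
  | cons c cs ih =>
    rintro (_ | ⟨x, s⟩) hs
    · exact absurd rfl hs
    have hne : expand c (x :: s) ≠ [] := by
      rw [expand_cons]
      exact flatMap_absUnit_ne_nil _ _ _
    obtain ⟨a, ha, h⟩ := ih _ hne
    refine ⟨absCode x.rot c :: a, by simp [ha], ?_⟩
    rw [List.foldl_cons, h, expand_cons, iterUnit_cons]

theorem iterUnit_eq_encoded (a : List Code) : ∀ s : List OBase, s ≠ [] →
    ∃ cs : List Code, cs.length = a.length ∧ cs.foldl (fun s c => expand c s) s = iterUnit a s := by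
  induction a with
  | nil => exact fun s _ => ⟨[], rfl, rfl⟩
  | cons c a ih =>
    rintro (_ | ⟨x, s⟩) hs
    · exact absurd rfl hs
    have hne := flatMap_absUnit_ne_nil c x s
    obtain ⟨cs, hl, h⟩ := ih _ hne
    refine ⟨absCode x.rot c :: cs, by simp [hl], ?_⟩
    rw [List.foldl_cons, expand_cons, absCode_absCode, h, iterUnit_cons]

theorem Curve.exists_iterUnit {k : ℕ} (P : Curve k) :
    ∃ (x : OBase) (a : List Code), a.length = k ∧ P.1 = iterUnit a [x] := by
  obtain ⟨s, x, cs, hl, hs⟩ := P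
  obtain ⟨a, ha, h⟩ := encoded_eq_iterUnit cs [x] (by simp)
  exact ⟨x, a, ha.trans hl, by rw [← h]; exact hs.symm⟩

/-- The curve of level `n + 1` with standard coarsest path and absolute codes `a` at the finer
levels. -/
def stdCurve {n : ℕ} (e f : Fin 3) (a : List.Vector Code n) : Curve (n + 1) :=
  ⟨iterUnit a.1 (stdU e f), by
    obtain ⟨c, x, h⟩ := exists_absUnit_eq_stdU e f
    obtain ⟨cs, hl, hs⟩ := iterUnit_eq_encoded (c :: a.1) [x] (by simp)
    refine ⟨x, cs, by simpa [a.2] using hl, ?_⟩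
    rw [encoded, hs, iterUnit_cons, List.flatMap_singleton, h]⟩

/-! ### Steps and points -/

/-- The steps out of all bases of a sequence, including the last one. -/
def steps (s : List OBase) : List (ℤ × ℤ) := s.map OBase.step

/-- The points visited from `p` by a sequence of steps. -/
def walk (p : ℤ × ℤ) (d : List (ℤ × ℤ)) : List (ℤ × ℤ) := d.scanl (· + ·) p

/-- The steps between consecutive bases of a sequence. -/
def dirs (s : List OBase) : List (ℤ × ℤ) := (steps s).dropLast

theorem pointsFrom_eq_walk (p : ℤ × ℤ) (s : List OBase) (hs : s ≠ []) :
    pointsFrom p s = walk p (dirs s) := by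
  induction s generalizing p with
  | nil => exact absurd rfl hs
  | cons x s ih =>
    cases s with
    | nil => simp [pointsFrom, walk, dirs, steps]
    | cons y s =>
      rw [pointsFrom, ih _ (by simp)]
      simp [walk, dirs, steps]

theorem walk_injective {p q : ℤ × ℤ} {d e : List (ℤ × ℤ)} (h : walk p d = walk q e) : d = e := by
  induction d generalizing p q e with
  | nil =>
    cases e with
    | nil => rfl
    | cons y e => simpa [walk] using congrArg List.length h
  | cons x d ih =>
    cases e with
    | nil => simpa [walk] using congrArg List.length h
    | cons y e =>
      simp only [walk, List.scanl_cons, List.cons.injEq] at h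
      obtain ⟨rfl, h⟩ := h
      have hh : p + x = p + y := by
        have := congrArg List.head? h
        simpa [List.head?_scanl] using this
      rw [ih h, add_left_cancel hh]

theorem map_walk (f : ℤ × ℤ → ℤ × ℤ) (L : ℤ × ℤ → ℤ × ℤ) (hf : ∀ p d, f (p + d) = f p + L d)
    (p : ℤ × ℤ) (d : List (ℤ × ℤ)) : (walk p d).map f = walk (f p) (d.map L) := by
  induction d generalizing p with
  | nil => simp [walk]
  | cons x d ih =>
    have := ih (p + x)
    simp only [walk, List.scanl_cons, List.map_cons] at this ⊢
    rw [this, hf]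

theorem reverse_walk (p : ℤ × ℤ) (d : List (ℤ × ℤ)) :
    (walk p d).reverse = walk (p + d.sum) (d.map Neg.neg).reverse := by
  induction d generalizing p with
  | nil => simp [walk]
  | cons x d ih =>
    have h := ih (p + x)
    simp only [walk, List.scanl_cons, List.reverse_cons, List.map_cons, List.sum_cons] at h ⊢
    rw [h, ← add_assoc]
    have key : ∀ (q : ℤ × ℤ) (l : List (ℤ × ℤ)), (l ++ [-x]).scanl (· + ·) q =
        l.scanl (· + ·) q ++ [q + l.sum + -x] := by
      intro q l
      induction l generalizing q with
      | nil => simp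
      | cons y l ih => simp [ih, add_assoc]
    rw [key, List.sum_reverse]
    congr 2
    have : (d.map Neg.neg).sum = - d.sum := by
      rw [List.sum_neg]
    rw [this]; abel

theorem pointsFrom_append (p : ℤ × ℤ) (s t : List OBase) :
    pointsFrom p (s ++ t) = pointsFrom p s ++ pointsFrom (p + (steps s).sum) t := by
  induction s generalizing p with
  | nil => simp [pointsFrom, steps]
  | cons x s ih => simp [pointsFrom, ih, steps, add_assoc]

theorem length_pointsFrom (p : ℤ × ℤ) (s : List OBase) : (pointsFrom p s).length = s.length := by
  induction s generalizing p with
  | nil => rfl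
  | cons x s ih => simp [pointsFrom, ih]

/-! ### Plane moves -/

theorem rot90_mem : rot90 ∈ planeMoves := Subgroup.subset_closure (by simp)
theorem hrefl_mem : hrefl ∈ planeMoves := Subgroup.subset_closure (by simp)
theorem translation_mem (v : ℤ × ℤ) : Equiv.addLeft v ∈ planeMoves :=
  Subgroup.subset_closure (by simp)

theorem movePlane_mem (i : ZMod 4) (b : Bool) : movePlane i b ∈ planeMoves := by
  cases b
  · exact pow_mem rot90_mem _
  · exact mul_mem (pow_mem rot90_mem _) hrefl_mem

theorem movePlane_add (i : ZMod 4) (b : Bool) (p q : ℤ × ℤ) :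
    movePlane i b (p + q) = movePlane i b p + movePlane i b q := by
  have h : ∀ n : ℕ, ∀ p q : ℤ × ℤ, (rot90 ^ n) (p + q) = (rot90 ^ n) p + (rot90 ^ n) q := by
    intro n
    induction n with
    | zero => simp
    | succ n ih =>
      intro p q
      simp only [pow_succ, Equiv.Perm.mul_apply]
      rw [← ih]
      congr 1
      simp [rot90]; ring
  cases b
  · exact h _ p q
  · simp only [movePlane, if_true, Equiv.Perm.mul_apply]
    rw [← h]
    congr 1
    simp [hrefl]; ring

/-- Plane moves are affine. -/
theorem exists_linear_of_mem {f : Equiv.Perm (ℤ × ℤ)} (hf : f ∈ planeMoves) :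
    ∃ L : (ℤ × ℤ) ≃+ (ℤ × ℤ), ∀ p d, f (p + d) = f p + L d := by
  induction hf using Subgroup.closure_induction with
  | mem f hf =>
    rcases hf with (rfl | rfl) | ⟨v, rfl⟩
    · exact ⟨{ rot90 with map_add' := movePlane_add 1 false }, movePlane_add 1 false⟩
    · exact ⟨{ hrefl with map_add' := movePlane_add 0 true }, movePlane_add 0 true⟩
    · exact ⟨AddEquiv.refl _, fun p d => by simp [add_assoc]⟩
  | one => exact ⟨AddEquiv.refl _, fun p d => rfl⟩
  | mul f g _ _ hf hg =>
    obtain ⟨L, hL⟩ := hf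
    obtain ⟨M, hM⟩ := hg
    exact ⟨M.trans L, fun p d => by simp [hL, hM]⟩
  | inv f _ hf =>
    obtain ⟨L, hL⟩ := hf
    refine ⟨L.symm, fun p d => ?_⟩
    rw [Equiv.Perm.inv_eq_iff_eq, hL]
    simp

theorem isCornerOf_map {f : Equiv.Perm (ℤ × ℤ)} (hf : f ∈ planeMoves) :
    ∀ p S, IsCornerOf (f p) (S.map f) ↔ IsCornerOf p S := by
  induction hf using Subgroup.closure_induction with
  | mem f hf =>
    rcases hf with (rfl | rfl) | ⟨v, rfl⟩ <;> intro p S <;>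
      simp only [IsCornerOf, List.forall_mem_map, rot90, hrefl, Equiv.coe_fn_mk, neg_le_neg_iff,
        Equiv.coe_addLeft, Prod.fst_add, Prod.snd_add, add_le_add_iff_left] <;> tauto
  | one => simp
  | mul f g _ _ hf hg =>
    intro p S
    have h := (hf (g p) (S.map g)).trans (hg p S)
    rwa [List.map_map] at h
  | inv f _ hf => intro p S; rw [← hf]; simp [Function.comp_def]

/-! ### Standard curves -/

theorem iterUnit_moveTile (i : ZMod 4) (b : Bool) (a : List Code) (s : List OBase) :
    iterUnit (a.map (moveCode i b)) (s.map (moveTile i b)) = (iterUnit a s).map (moveTile i b) := by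
  induction a generalizing s with
  | nil => rfl
  | cons c a ih =>
    rw [List.map_cons, iterUnit_cons, iterUnit_cons, ← ih]
    congr 1
    simp [List.flatMap_map, List.map_flatMap, absUnit_moveTile]

theorem pointsFrom_moveTile (i : ZMod 4) (b : Bool) (p : ℤ × ℤ) (s : List OBase) :
    pointsFrom (movePlane i b p) (s.map (moveTile i b)) = (pointsFrom p s).map (movePlane i b) := by
  induction s generalizing p with
  | nil => rfl
  | cons x s ih => simp [pointsFrom, ← ih, movePlane_add, step_moveTile]

/-- Every curve of positive level is a rotated or reflected standard curve. The move does not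
reverse the curve, hence it preserves being corner-induced. -/
theorem exists_stdCurve {n : ℕ} (P : Curve (n + 1)) :
    ∃ (e f : Fin 3) (a : List.Vector Code n), ∃ g ∈ planeMoves,
      P.path = (stdCurve e f a).path.map g := by
  obtain ⟨x, a, ha, hP⟩ := P.exists_iterUnit
  obtain _ | ⟨c, a⟩ := a
  · simp at ha
  obtain ⟨i, b, e, f, h⟩ := exists_stdU c x
  refine ⟨e, f, ⟨a.map (moveCode i b), by simpa using ha⟩, movePlane i b, movePlane_mem i b, ?_⟩
  have h0 : movePlane i b 0 = 0 := by simpa using movePlane_add i b 0 0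
  have ha' : (a.map (moveCode i b)).map (moveCode i b) = a := by
    rw [List.map_map]; conv_rhs => rw [← List.map_id a]
    exact List.map_congr_left fun c _ => moveCode_moveCode i b c
  change pointsFrom 0 P.1 =
    (pointsFrom 0 (iterUnit (a.map (moveCode i b)) (stdU e f))).map (movePlane i b)
  rw [hP, iterUnit_cons, List.flatMap_singleton, h, ← pointsFrom_moveTile, h0,
    ← iterUnit_moveTile, ha']

/-! ### Recovering coarser levels and codes -/

theorem step_getLast_absUnit : ∀ (c : Code) (x : OBase), x.IsOpen →
    (steps (absUnit c x)).getLast? = some x.step := by decide +kernel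

theorem eq_of_steps_absUnit_eq : ∀ (c c' : Code) (x : OBase), x.IsOpen →
    steps (absUnit c x) = steps (absUnit c' x) → c = c' := by decide +kernel

theorem length_flatMap_absUnit (c : Code) (s : List OBase) :
    (s.flatMap (absUnit c)).length = 4 * s.length := by
  induction s with
  | nil => rfl
  | cons x s ih =>
    rw [List.flatMap_cons, List.length_append, ih, length_absUnit, List.length_cons]
    ring

theorem length_iterUnit (a : List Code) (s : List OBase) :
    (iterUnit a s).length = 4 ^ a.length * s.length := by
  induction a generalizing s with
  | nil => simp [iterUnit]
  | cons c a ih => rw [iterUnit_cons, ih, length_flatMap_absUnit, List.length_cons, pow_succ]; ring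

theorem flatMap_absUnit_open (c : Code) (s : List OBase) :
    ∀ y ∈ s.flatMap (absUnit c), y.IsOpen := by
  intro y hy
  obtain ⟨x, -, hx⟩ := List.mem_flatMap.1 hy
  exact absUnit_open c x y hx

theorem iterUnit_open (a : List Code) {s : List OBase} (hs : ∀ y ∈ s, y.IsOpen) :
    ∀ y ∈ iterUnit a s, y.IsOpen := by
  induction a generalizing s with
  | nil => exact hs
  | cons c a ih => exact ih (flatMap_absUnit_open c s)

theorem isChain_flatMap_absUnit (c : Code) {s : List OBase} (ho : ∀ y ∈ s, y.IsOpen)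
    (hs : s.IsChain Joins) : (s.flatMap (absUnit c)).IsChain Joins := by
  induction s with
  | nil => exact List.isChain_nil
  | cons x s ih =>
    obtain ⟨-, hc, -, hl⟩ := absUnit_spec c x (ho x (by simp))
    rw [List.flatMap_cons, List.isChain_append]
    refine ⟨hc, ih (fun y hy => ho y (by simp [hy])) hs.tail, ?_⟩
    intro u hu v hv
    cases s with
    | nil => simp at hv
    | cons y s =>
      obtain ⟨hn, -, hh, -⟩ := absUnit_spec c y (ho y (by simp))
      have hv' : v ∈ (absUnit c y).head? := by
        rw [List.flatMap_cons] at hv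
        cases h : absUnit c y with
        | nil => simp [h] at hn
        | cons z t => simpa [h] using hv
      have hxy : Joins x y := by
        rw [List.isChain_cons_cons] at hs; exact hs.1
      rw [Joins, hh v hv', hl u hu]; exact hxy

theorem isChain_iterUnit (a : List Code) {s : List OBase} (ho : ∀ y ∈ s, y.IsOpen)
    (hs : s.IsChain Joins) : (iterUnit a s).IsChain Joins := by
  induction a generalizing s with
  | nil => exact hs
  | cons c a ih => exact ih (flatMap_absUnit_open c s) (isChain_flatMap_absUnit c ho hs)

/-- Every fourth step of an expanded sequence is a step of the sequence itself, because a unit is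
left in the same direction as its base. -/
theorem steps_of_steps_flatMap {c c' : Code} {L : ℤ × ℤ → ℤ × ℤ} : ∀ {s t : List OBase},
    (∀ y ∈ s, y.IsOpen) → (∀ y ∈ t, y.IsOpen) →
    steps (s.flatMap (absUnit c)) = (steps (t.flatMap (absUnit c'))).map L →
    steps s = (steps t).map L
  | [], [], _, _, _ => rfl
  | [], y :: t, _, _, h => by
    have := congrArg List.length h
    simp only [steps, List.length_map, length_flatMap_absUnit, List.length_cons,
      List.length_nil] at this
    omega
  | x :: s, [], _, _, h => by
    have := congrArg List.length h
    simp only [steps, List.length_map, length_flatMap_absUnit, List.length_cons,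
      List.length_nil] at this
    omega
  | x :: s, y :: t, hs, ht, h => by
    have h' : steps (absUnit c x) ++ steps (s.flatMap (absUnit c)) =
        (steps (absUnit c' y)).map L ++ (steps (t.flatMap (absUnit c'))).map L := by
      simpa [steps] using h
    obtain ⟨h1, h2⟩ := List.append_inj h' (by simp [steps, length_absUnit])
    have h3 := congrArg List.getLast? h1
    rw [List.getLast?_map, step_getLast_absUnit c x (hs x (by simp)),
      step_getLast_absUnit c' y (ht y (by simp))] at h3
    have ih := steps_of_steps_flatMap (fun z hz => hs z (by simp [hz]))
      (fun z hz => ht z (by simp [hz])) h2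
    simp only [steps, List.map_cons, Option.map_some, Option.some.injEq] at h3 ih ⊢
    rw [h3, ih]

theorem steps_of_steps_iterUnit {L : ℤ × ℤ → ℤ × ℤ} {a b : List Code} (hab : a.length = b.length)
    {s t : List OBase} (hs : ∀ y ∈ s, y.IsOpen) (ht : ∀ y ∈ t, y.IsOpen)
    (h : steps (iterUnit a s) = (steps (iterUnit b t)).map L) : steps s = (steps t).map L := by
  induction a generalizing b s t with
  | nil =>
    obtain rfl : b = [] := List.length_eq_zero_iff.1 hab.symm
    exact h
  | cons c a ih =>
    obtain _ | ⟨c', b⟩ := b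
    · simp at hab
    exact steps_of_steps_flatMap hs ht
      (ih (by simpa using hab) (flatMap_absUnit_open c s) (flatMap_absUnit_open c' t) h)

theorem codes_eq_of_steps_iterUnit {a b : List Code} (hab : a.length = b.length) {x : OBase}
    {s : List OBase} (hs : ∀ y ∈ x :: s, y.IsOpen)
    (h : steps (iterUnit a (x :: s)) = steps (iterUnit b (x :: s))) : a = b := by
  induction a generalizing b x s with
  | nil => exact (List.length_eq_zero_iff.1 hab.symm).symm
  | cons c a ih =>
    obtain _ | ⟨c', b⟩ := b
    · simp at hab
    have hab' : a.length = b.length := by simpa using hab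
    have h1 : steps ((x :: s).flatMap (absUnit c)) = steps ((x :: s).flatMap (absUnit c')) := by
      simpa using steps_of_steps_iterUnit (L := id) hab' (flatMap_absUnit_open c (x :: s))
        (flatMap_absUnit_open c' (x :: s)) (by simpa [iterUnit_cons] using h)
    have h2 : steps (absUnit c x) ++ steps (s.flatMap (absUnit c)) =
        steps (absUnit c' x) ++ steps (s.flatMap (absUnit c')) := by simpa [steps] using h1
    obtain rfl : c = c' := eq_of_steps_absUnit_eq c c' x (hs x (by simp))
      (List.append_inj h2 (by simp [steps, length_absUnit])).1
    obtain ⟨y, t, hy⟩ := List.exists_cons_of_ne_nil (flatMap_absUnit_ne_nil c x s)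
    rw [iterUnit_cons, iterUnit_cons, hy] at h
    rw [ih hab' (hy ▸ flatMap_absUnit_open c (x :: s)) h]

/-! ### Entries with the same path -/

/-- The units of `x` and `y` of absolute code `c` have the same steps. -/
def Merges (x y : OBase) (c : Code) : Prop := steps (absUnit c x) = steps (absUnit c y)

instance (x y : OBase) (c : Code) : Decidable (Merges x y c) := inferInstanceAs (Decidable (_ = _))

/-- If the units of two bases with the same exit have the same steps, they differ only in their
first bases, and these are again merged by exactly the same codes. -/
theorem merges_spec : ∀ (c : Code) (x y : OBase), x.IsOpen → y.IsOpen → x.step = y.step → x ≠ y →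
    Merges x y c → (absUnit c x).tail = (absUnit c y).tail ∧
      ∀ x' ∈ (absUnit c x).head?, ∀ y' ∈ (absUnit c y).head?, x'.step = y'.step ∧ x' ≠ y' ∧
        ∀ c', Merges x' y' c' ↔ Merges x y c' := by
  decide +kernel

/-- Two entries of an open base with a given exit stay indistinguishable exactly as long as every
code merges them. -/
theorem steps_iterUnit_eq_iff (a : List Code) {x y : OBase} (hx : x.IsOpen) (hy : y.IsOpen)
    (hs : x.step = y.step) (hne : x ≠ y) :
    steps (iterUnit a [x]) = steps (iterUnit a [y]) ↔ ∀ c ∈ a, Merges x y c := by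
  induction a generalizing x y with
  | nil => simp [iterUnit, steps, hs]
  | cons c a ih =>
    rw [iterUnit_cons, iterUnit_cons, List.flatMap_singleton, List.flatMap_singleton]
    by_cases hm : Merges x y c
    · obtain ⟨ht, hh⟩ := merges_spec c x y hx hy hs hne hm
      have hox := absUnit_open c x
      have hoy := absUnit_open c y
      have hlx := length_absUnit c x
      have hly := length_absUnit c y
      cases h1 : absUnit c x with
      | nil => simp [h1] at hlx
      | cons x' t =>
      cases h2 : absUnit c y with
      | nil => simp [h2] at hly
      | cons y' t' =>
      rw [h1, h2] at ht hh
      rw [h1] at hox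
      rw [h2] at hoy
      obtain rfl : t = t' := ht
      obtain ⟨h3, h4, h5⟩ := hh x' rfl y' rfl
      have ih' := ih (hox x' (by simp)) (hoy y' (by simp)) h3 h4
      rw [← List.singleton_append (x := x'), ← List.singleton_append (x := y'), iterUnit_append,
        iterUnit_append, steps, steps, List.map_append, List.map_append, List.append_left_inj]
      simp only [List.forall_mem_cons, hm, true_and]
      simp only [h5] at ih'
      exact ih'
    · constructor
      · intro h
        have h' := steps_of_steps_iterUnit (a := a) (b := a) (L := id) rfl (absUnit_open c x)
          (absUnit_open c y) (by simpa using h)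
        exact absurd (h'.trans (List.map_id _)) hm
      · intro h
        exact absurd (h c (by simp)) hm

theorem startTile_spec : ∀ e : Fin 3, (startTile e).IsOpen ∧ (startTile e).step = (0, 1) := by
  decide +kernel

theorem merges_startTile : ∀ c : Code, (Merges (startTile 0) (startTile 1) c ↔ c = .one) ∧
    (Merges (startTile 0) (startTile 2) c ↔ c = .two) ∧
    ¬ Merges (startTile 1) (startTile 2) c := by
  decide +kernel

/-- A representative of the entries that give the same path as the entry `e` for the nonempty list
of codes `a`. -/
def entryClass (a : List Code) (e : Fin 3) : Fin 3 :=
  if (∀ c ∈ a, c = .one) ∧ e = 1 ∨ (∀ c ∈ a, c = .two) ∧ e = 2 then 0 else e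

theorem steps_startTile_eq_iff {a : List Code} (ha : a ≠ []) (e e' : Fin 3) :
    steps (iterUnit a [startTile e]) = steps (iterUnit a [startTile e']) ↔
      entryClass a e = entryClass a e' := by
  have key : ∀ e e', startTile e ≠ startTile e' →
      (steps (iterUnit a [startTile e]) = steps (iterUnit a [startTile e']) ↔
        ∀ c ∈ a, Merges (startTile e) (startTile e') c) := fun e e' h =>
    steps_iterUnit_eq_iff a (startTile_spec e).1 (startTile_spec e').1
      ((startTile_spec e).2.trans (startTile_spec e').2.symm) h
  have k01 := key 0 1 (by decide)
  have k02 := key 0 2 (by decide)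
  have k12 := key 1 2 (by decide)
  simp only [fun c => (merges_startTile c).1] at k01
  simp only [fun c => (merges_startTile c).2.1] at k02
  simp only [fun c => iff_false_intro (merges_startTile c).2.2] at k12
  obtain ⟨c, a', rfl⟩ := List.exists_cons_of_ne_nil ha
  have hne : ¬ ((∀ d ∈ c :: a', d = .one) ∧ ∀ d ∈ c :: a', d = Code.two) := by
    rintro ⟨h, h'⟩
    have := (h c (by simp)).symm.trans (h' c (by simp))
    contradiction
  have k12' : steps (iterUnit (c :: a') [startTile 1]) ≠ steps (iterUnit (c :: a') [startTile 2]) :=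
    fun h => k12.1 h c (by simp)
  have c0 : entryClass (c :: a') 0 = 0 := by simp [entryClass]
  have c1 : (∀ d ∈ c :: a', d = .one) → entryClass (c :: a') 1 = 0 :=
    fun h => if_pos (Or.inl ⟨h, rfl⟩)
  have c1' : ¬ (∀ d ∈ c :: a', d = .one) → entryClass (c :: a') 1 = 1 :=
    fun h => if_neg (by
      rintro (⟨h', -⟩ | ⟨-, h'⟩)
      exacts [h h', absurd h' (by decide)])
  have c2 : (∀ d ∈ c :: a', d = .two) → entryClass (c :: a') 2 = 0 :=
    fun h => if_pos (Or.inr ⟨h, rfl⟩)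
  have c2' : ¬ (∀ d ∈ c :: a', d = .two) → entryClass (c :: a') 2 = 2 :=
    fun h => if_neg (by
      rintro (⟨-, h'⟩ | ⟨h', -⟩)
      exacts [absurd h' (by decide), h h'])
  have k10 := eq_comm.trans k01
  have k20 := eq_comm.trans k02
  clear key k12 ha
  generalize c :: a' = b at *
  generalize (∀ d ∈ b, d = Code.one) = p at *
  generalize (∀ d ∈ b, d = Code.two) = q at *
  by_cases hp : p <;> by_cases hq : q <;> fin_cases e <;> fin_cases e' <;>
    simp_all [k12'.symm]

/-! ### Reversal and the classification of shapes -/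

theorem flatMap_absUnit_revRefl (c : Code) {s : List OBase} (hs : ∀ y ∈ s, y.IsOpen) :
    (s.map revRefl).reverse.flatMap (absUnit c) =
      ((s.flatMap (absUnit c)).map revRefl).reverse := by
  induction s with
  | nil => rfl
  | cons x s ih =>
    simp only [List.map_cons, List.reverse_cons, List.flatMap_append,
      List.flatMap_cons, List.flatMap_nil, List.append_nil, List.map_append, List.reverse_append]
    rw [ih fun y hy => hs y (by simp [hy]), absUnit_revRefl c x (hs x (by simp))]

theorem iterUnit_revRefl (a : List Code) {s : List OBase} (hs : ∀ y ∈ s, y.IsOpen) :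
    iterUnit a (s.map revRefl).reverse = ((iterUnit a s).map revRefl).reverse := by
  induction a generalizing s with
  | nil => rfl
  | cons c a ih =>
    rw [iterUnit_cons, flatMap_absUnit_revRefl c hs, ih (flatMap_absUnit_open c s), iterUnit_cons]

/-- Vertical reflection. It is the effect of `revRefl` on steps, as reversal negates them. -/
def vrefl : (ℤ × ℤ) →+ (ℤ × ℤ) where
  toFun p := (p.1, -p.2)
  map_zero' := by simp
  map_add' p q := by simp; ring

theorem step_revRefl : ∀ x y : OBase, x.IsOpen → y.IsOpen → Joins x y →
    (revRefl y).step = vrefl x.step := by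
  decide +kernel

/-- The step out of a reversed base is the negative of the step into the original one, hence the
shift by one position that turns all steps of the tail into the inner steps of the sequence. -/
theorem dirs_revRefl {s : List OBase} (ho : ∀ y ∈ s, y.IsOpen) (hs : s.IsChain Joins) :
    dirs (s.map revRefl).reverse = ((dirs s).map vrefl).reverse := by
  cases s with
  | nil => rfl
  | cons x s =>
    have h : steps (s.map revRefl) = (dirs (x :: s)).map vrefl := by
      induction s generalizing x with
      | nil => simp [steps, dirs]
      | cons y s ih =>
        rw [List.isChain_cons_cons] at hs
        have := ih y (fun z hz => ho z (by simp_all)) hs.2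
        simp only [steps, dirs, List.map_cons, List.dropLast_cons_cons] at this ⊢
        rw [step_revRefl x y (ho x (by simp)) (ho y (by simp)) hs.1, this]
    rw [← h]
    simp [dirs, steps]

theorem stdU_revRefl : ∀ e f, ((stdU e f).map revRefl).reverse = stdU f e := by decide +kernel

theorem stdU_spec : ∀ e f, (∀ y ∈ stdU e f, y.IsOpen) ∧ (stdU e f).IsChain Joins := by
  decide +kernel

theorem dirs_swap (a : List Code) (e f : Fin 3) :
    dirs (iterUnit a (stdU f e)) = ((dirs (iterUnit a (stdU e f))).map vrefl).reverse := by
  obtain ⟨ho, hc⟩ := stdU_spec e f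
  rw [← stdU_revRefl e f, iterUnit_revRefl a ho,
    dirs_revRefl (iterUnit_open a ho) (isChain_iterUnit a ho hc)]

theorem iterUnit_ne_nil (a : List Code) {s : List OBase} (hs : s ≠ []) : iterUnit a s ≠ [] := by
  intro h
  have := congrArg List.length h
  simp [length_iterUnit, hs] at this

theorem path_stdCurve {n : ℕ} (e f : Fin 3) (a : List.Vector Code n) :
    (stdCurve e f a).path = walk 0 (dirs (iterUnit a.1 (stdU e f))) :=
  pointsFrom_eq_walk _ _ (iterUnit_ne_nil _ (by simp [stdU]))

theorem sameShape_swap {n : ℕ} (e f : Fin 3) (a : List.Vector Code n) :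
    SameShape (stdCurve e f a) (stdCurve f e a) := by
  set d := dirs (iterUnit a.1 (stdU e f)) with hd
  -- The translation moves the last point of the reflected path to the origin.
  refine ⟨Equiv.addLeft (-(d.map hrefl).sum) * hrefl, mul_mem (translation_mem _) hrefl_mem,
    Or.inr ?_⟩
  rw [path_stdCurve, path_stdCurve, dirs_swap, ← hd,
    map_walk _ hrefl (fun p q => by simp [hrefl, add_assoc]; ring_nf), reverse_walk]
  have h0 : hrefl 0 = 0 := by simp [hrefl]
  simp only [Equiv.Perm.mul_apply, h0, Equiv.coe_addLeft, add_zero, neg_add_cancel, List.map_map]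
  congr 2
  refine List.map_congr_left fun p _ => ?_
  simp [vrefl, hrefl]

theorem dirs_stdU (a : List Code) (e f : Fin 3) :
    dirs (iterUnit a (stdU e f)) = steps (iterUnit a [startTile e]) ++
      (steps (iterUnit a [⟨.R, 0⟩, ⟨.R, 3⟩]) ++ dirs (iterUnit a [revRefl (startTile f)])) := by
  have h : stdU e f = [startTile e] ++ ([⟨.R, 0⟩, ⟨.R, 3⟩] ++ [revRefl (startTile f)]) := rfl
  rw [h, iterUnit_append, iterUnit_append]
  simp only [dirs, steps, List.map_append]
  rw [List.dropLast_append_of_ne_nil, List.dropLast_append_of_ne_nil] <;>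
    simp [iterUnit_ne_nil]

theorem sameShape_of_entryClass_left {n : ℕ} {a : List.Vector Code n} (ha : a.1 ≠ [])
    {e e' : Fin 3} (f : Fin 3) (h : entryClass a.1 e = entryClass a.1 e') :
    SameShape (stdCurve e f a) (stdCurve e' f a) := by
  refine ⟨1, one_mem _, Or.inl ?_⟩
  rw [path_stdCurve, path_stdCurve, dirs_stdU, dirs_stdU, (steps_startTile_eq_iff ha e e').2 h]
  simp

theorem entryClass_of_dirs_eq {a : List Code} (ha : a ≠ []) {e f e' f' : Fin 3}
    (h : dirs (iterUnit a (stdU e f)) = dirs (iterUnit a (stdU e' f'))) :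
    entryClass a e = entryClass a e' := by
  rw [dirs_stdU, dirs_stdU] at h
  exact (steps_startTile_eq_iff ha e e').1 (List.append_inj h (by simp [steps, length_iterUnit])).1

/-- A linear map between the steps of two standard curves preserves the coarsest steps up and right,
hence it is the identity; the codes then agree as the two inner bases are the same. -/
theorem eq_of_dirs_eq_map {L : (ℤ × ℤ) →+ (ℤ × ℤ)} {a b : List Code} (hab : a.length = b.length)
    {e f e' f' : Fin 3}
    (h : dirs (iterUnit a (stdU e f)) = (dirs (iterUnit b (stdU e' f'))).map L) :
    a = b ∧ dirs (iterUnit a (stdU e f)) = dirs (iterUnit b (stdU e' f')) := by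
  -- The first three quarters of the steps determine the coarsest steps up, right and down.
  have hL : ⇑L = id := by
    have h' := h
    rw [dirs_stdU, dirs_stdU, ← List.append_assoc, ← List.append_assoc, List.map_append] at h'
    have h1 : steps (iterUnit a ([startTile e] ++ [⟨.R, 0⟩, ⟨.R, 3⟩])) =
        (steps (iterUnit b ([startTile e'] ++ [⟨.R, 0⟩, ⟨.R, 3⟩]))).map L := by
      rw [iterUnit_append, iterUnit_append]
      simpa [steps] using (List.append_inj h' (by simp [steps, length_iterUnit, hab])).1
    have h2 := steps_of_steps_iterUnit (L := L) hab (s := [startTile e] ++ [⟨.R, 0⟩, ⟨.R, 3⟩])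
      (t := [startTile e'] ++ [⟨.R, 0⟩, ⟨.R, 3⟩])
      (fun y hy => (stdU_spec e f).1 y (by simp [stdU] at hy ⊢; tauto))
      (fun y hy => (stdU_spec e' f').1 y (by simp [stdU] at hy ⊢; tauto)) h1
    have e1 : (⟨.R, 0⟩ : OBase).step = (1, 0) := rfl
    simp only [steps, List.cons_append, List.nil_append, List.map_cons, (startTile_spec _).2, e1,
      List.cons.injEq] at h2
    obtain ⟨h3, h4, -⟩ := h2
    funext p
    have hp : p = p.1 • ((1 : ℤ), (0 : ℤ)) + p.2 • ((0 : ℤ), (1 : ℤ)) := by ext <;> simp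
    rw [hp, map_add, map_zsmul, map_zsmul, ← h3, ← h4]
    rfl
  rw [hL, List.map_id] at h
  refine ⟨?_, h⟩
  rw [dirs_stdU, dirs_stdU] at h
  have h1 := (List.append_inj h (by simp [steps, length_iterUnit, hab])).2
  have h2 := (List.append_inj h1 (by simp [steps, length_iterUnit, hab])).1
  exact codes_eq_of_steps_iterUnit hab (by decide) h2

/-- Classification of the shapes of standard curves. -/
theorem sameShape_iff {n : ℕ} (hn : n ≠ 0) {a b : List.Vector Code n} {e f e' f' : Fin 3} :
    SameShape (stdCurve e f a) (stdCurve e' f' b) ↔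
      a = b ∧ s(entryClass a.1 e, entryClass a.1 f) = s(entryClass a.1 e', entryClass a.1 f') := by
  have ha : a.1 ≠ [] := by
    intro h
    have := a.2
    rw [h] at this
    exact hn this.symm
  have trans {P Q S : Curve (n + 1)} : SameShape P Q → SameShape Q S → SameShape P S :=
    (sameShape_equivalence (n + 1)).trans
  constructor
  · have key : ∀ {e f : Fin 3} {L : (ℤ × ℤ) →+ (ℤ × ℤ)},
        dirs (iterUnit b.1 (stdU e' f')) = (dirs (iterUnit a.1 (stdU e f))).map L →
        a = b ∧ entryClass a.1 e = entryClass a.1 e' ∧ entryClass a.1 f = entryClass a.1 f' := by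
      intro e f L h
      obtain ⟨h1, h2⟩ := eq_of_dirs_eq_map (b.2.trans a.2.symm) h
      obtain rfl : b = a := Subtype.ext h1
      refine ⟨rfl, (entryClass_of_dirs_eq ha h2).symm, ?_⟩
      have h3 : dirs (iterUnit b.1 (stdU f' e')) = dirs (iterUnit b.1 (stdU f e)) := by
        rw [dirs_swap, h2, ← dirs_swap]
      exact (entryClass_of_dirs_eq ha h3).symm
    rintro ⟨g, hg, h⟩
    obtain ⟨L, hL⟩ := exists_linear_of_mem hg
    rw [path_stdCurve, path_stdCurve, map_walk g L hL, reverse_walk] at h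
    rcases h with h | h
    · obtain ⟨rfl, h1, h2⟩ := key (L := L.toAddMonoidHom) (walk_injective h)
      exact ⟨rfl, by rw [h1, h2]⟩
    -- Exchanging `e` and `f` turns a reversed match into a match without reversal.
    · have h' := walk_injective h
      rw [dirs_swap a.1 f e, List.map_reverse, List.map_reverse, List.reverse_reverse,
        List.map_map, List.map_map] at h'
      obtain ⟨rfl, h1, h2⟩ := key (L := (-L.toAddMonoidHom).comp vrefl) h'
      exact ⟨rfl, by rw [h1, h2, Sym2.eq_swap]⟩
  · rintro ⟨rfl, h⟩
    have step {e f e' f' : Fin 3} (h1 : entryClass a.1 e = entryClass a.1 e')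
        (h2 : entryClass a.1 f = entryClass a.1 f') :
        SameShape (stdCurve e f a) (stdCurve e' f' a) :=
      trans (sameShape_of_entryClass_left ha f h1) (trans (sameShape_swap _ _ _)
        (trans (sameShape_of_entryClass_left ha e' h2) (sameShape_swap _ _ _)))
    rcases Sym2.eq_iff.1 h with ⟨h1, h2⟩ | ⟨h1, h2⟩
    · exact step h1 h2
    · exact trans (step h1 h2) (sameShape_swap _ _ _)

/-! ### The square filled by an expanded base -/

/-- The binary digit of a code. -/
def bit (c : Code) : ℤ := if c = .two then 1 else 0

/-- The number with binary digits `a`, the head being the leading digit. -/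
def offset : List Code → ℤ
  | [] => 0
  | c :: a => 2 ^ a.length * bit c + offset a

/-- The point at position `t` on the entry side of the square of points with coordinates from `0` to
`m`, when the square is entered in the direction of rotation `r`. Opposite sides are numbered in
opposite directions, as a half-turn preserves absolute codes. -/
def entryAt (r : ZMod 4) (m t : ℤ) : ℤ × ℤ :=
  if r = 0 then (t, 0) else if r = 1 then (m, m - t) else if r = 2 then (m - t, m) else (0, t)

/-- The entry point of an open base of rotation `r` expanded with the absolute codes `a`, relative
to the lower left corner of the square it fills. -/
def entryPt (a : List Code) (r : ZMod 4) : ℤ × ℤ := entryAt r (2 ^ a.length - 1) (offset a)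

theorem entryPt_cons (c : Code) (a : List Code) (r : ZMod 4) :
    entryPt (c :: a) r = (2 ^ a.length : ℤ) • entryAt r 1 (bit c) + entryPt a r := by
  simp only [entryPt, entryAt, offset, List.length_cons, pow_succ]
  split_ifs <;> ext <;> simp <;> ring

theorem sum_steps_absUnit : ∀ (c : Code) (x : OBase), x.IsOpen →
    entryAt x.rot 1 (bit c) + (steps (absUnit c x)).sum =
      (2 : ℤ) • x.step + entryAt x.exitRot 1 (bit c) := by
  decide +kernel

/-- A unit visits the four cells of a square of side length two. -/
theorem points_absUnit : ∀ (c : Code) (x : OBase), x.IsOpen →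
    (pointsFrom (entryAt x.rot 1 (bit c)) (absUnit c x)).Perm [(0, 0), (1, 0), (0, 1), (1, 1)] := by
  decide +kernel

theorem steps_append (s t : List OBase) : steps (s ++ t) = steps s ++ steps t := List.map_append

/-- If leaving each single expanded base leads to the entry point of the next square, the same
holds for connected sequences. -/
theorem sum_steps_chain {a : List Code}
    (h1 : ∀ x : OBase, x.IsOpen → entryPt a x.rot + (steps (iterUnit a [x])).sum =
      (2 ^ a.length : ℤ) • x.step + entryPt a x.exitRot)
    {s : List OBase} {x : OBase} (ho : ∀ y ∈ x :: s, y.IsOpen) (hc : (x :: s).IsChain Joins)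
    {r : ZMod 4} (hr : ∀ y ∈ (x :: s).getLast?, y.exitRot = r) :
    entryPt a x.rot + (steps (iterUnit a (x :: s))).sum =
      (2 ^ a.length : ℤ) • (steps (x :: s)).sum + entryPt a r := by
  induction s generalizing x with
  | nil =>
    rw [← hr x rfl, h1 x (ho x (by simp))]
    simp [steps]
  | cons y s ih =>
    rw [List.isChain_cons_cons] at hc
    have h := ih (fun z hz => ho z (List.mem_cons_of_mem _ hz)) hc.2
      (fun z hz => hr z (by simpa using hz))
    have hj : y.rot = x.exitRot := hc.1
    rw [← List.singleton_append (x := x), iterUnit_append, steps_append, steps_append,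
      List.sum_append, List.sum_append, ← add_assoc, h1 x (ho x (by simp)), ← hj, add_assoc, h,
      smul_add, ← add_assoc]
    simp [steps]

/-- Leaving an expanded base leads to the entry point of the neighbouring square in the exit
direction. -/
theorem sum_steps_iterUnit (a : List Code) : ∀ x : OBase, x.IsOpen →
    entryPt a x.rot + (steps (iterUnit a [x])).sum =
      (2 ^ a.length : ℤ) • x.step + entryPt a x.exitRot := by
  induction a with
  | nil =>
    intro x _
    have h : ∀ r, entryPt [] r = 0 := by decide +kernel
    simp [h, iterUnit, steps]
  | cons c a ih =>
    intro x hx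
    obtain ⟨hn, hc, hh, hl⟩ := absUnit_spec c x hx
    have ho := absUnit_open c x
    have hs := sum_steps_absUnit c x hx
    rw [iterUnit_cons, List.flatMap_singleton, entryPt_cons, entryPt_cons]
    cases h : absUnit c x with
    | nil => simp [h] at hn
    | cons y s =>
      rw [h] at hc hh hl ho hs
      rw [add_assoc, ← hh y rfl, sum_steps_chain ih ho hc hl, ← add_assoc, ← smul_add, hh y rfl, hs,
        smul_add, smul_smul, List.length_cons, pow_succ, add_assoc]

/-- Membership in the half-open square of side length `m` with lower left corner `z`. -/
def InBox (z : ℤ × ℤ) (m : ℤ) (q : ℤ × ℤ) : Prop :=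
  (z.1 ≤ q.1 ∧ q.1 < z.1 + m) ∧ (z.2 ≤ q.2 ∧ q.2 < z.2 + m)

/-- If single expanded bases fill squares, an expanded connected sequence fills the squares attached
to its points. -/
theorem mem_points_chain {a : List Code}
    (h1 : ∀ x : OBase, x.IsOpen → ∀ z q, q ∈ pointsFrom (z + entryPt a x.rot) (iterUnit a [x]) ↔
      InBox z (2 ^ a.length) q)
    {s : List OBase} {x : OBase} (ho : ∀ y ∈ x :: s, y.IsOpen) (hc : (x :: s).IsChain Joins)
    (z p q : ℤ × ℤ) :
    q ∈ pointsFrom (z + (2 ^ a.length : ℤ) • p + entryPt a x.rot) (iterUnit a (x :: s)) ↔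
      ∃ p' ∈ pointsFrom p (x :: s), InBox (z + (2 ^ a.length : ℤ) • p') (2 ^ a.length) q := by
  induction s generalizing x p with
  | nil => rw [h1 x (ho x (by simp))]; simp [pointsFrom]
  | cons y s ih =>
    rw [List.isChain_cons_cons] at hc
    have h := ih (fun z hz => ho z (List.mem_cons_of_mem _ hz)) hc.2 (p + x.step)
    have hj : y.rot = x.exitRot := hc.1
    have hp : z + (2 ^ a.length : ℤ) • p + entryPt a x.rot + (steps (iterUnit a [x])).sum =
        z + (2 ^ a.length : ℤ) • (p + x.step) + entryPt a y.rot := by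
      rw [add_assoc, sum_steps_iterUnit a x (ho x (by simp)), hj, smul_add]
      abel
    rw [← List.singleton_append (x := x), iterUnit_append, pointsFrom_append, List.mem_append,
      h1 x (ho x (by simp)), hp, h]
    simp [pointsFrom]

/-- The points of an expanded open base fill a square. -/
theorem mem_points_iterUnit (a : List Code) : ∀ x : OBase, x.IsOpen → ∀ z q,
    q ∈ pointsFrom (z + entryPt a x.rot) (iterUnit a [x]) ↔ InBox z (2 ^ a.length) q := by
  induction a with
  | nil =>
    intro x _ z q
    have h : ∀ r, entryPt [] r = 0 := by decide +kernel
    simp only [h, iterUnit, List.foldl_nil, pointsFrom, List.mem_singleton, InBox, List.length_nil,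
      pow_zero, Prod.ext_iff, add_zero]
    omega
  | cons c a ih =>
    intro x hx z q
    obtain ⟨hn, hc, hh, -⟩ := absUnit_spec c x hx
    have ho := absUnit_open c x
    have hs := points_absUnit c x hx
    rw [iterUnit_cons, List.flatMap_singleton, entryPt_cons, ← add_assoc]
    cases h : absUnit c x with
    | nil => simp [h] at hn
    | cons y s =>
      rw [h] at hc hh ho hs
      rw [← hh y rfl, mem_points_chain ih ho hc]
      rw [hh y rfl]
      simp only [hs.mem_iff]
      simp only [InBox, List.mem_cons, List.not_mem_nil, or_false, exists_eq_or_imp,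
        exists_eq_left, Prod.fst_add, Prod.snd_add, Prod.smul_mk, smul_eq_mul, mul_one,
        List.length_cons, pow_succ]
      have hm : (0 : ℤ) < 2 ^ a.length := by positivity
      generalize (2 : ℤ) ^ a.length = m at hm
      omega

/-- All codes coincide. -/
def IsConst (a : List Code) : Prop := (∀ c ∈ a, c = .one) ∨ ∀ c ∈ a, c = .two

/-- The position on the entry side is extreme only if all codes coincide. -/
theorem offset_spec (a : List Code) : 0 ≤ offset a ∧ offset a ≤ 2 ^ a.length - 1 ∧
    (offset a = 0 ↔ ∀ c ∈ a, c = .one) ∧ (offset a = 2 ^ a.length - 1 ↔ ∀ c ∈ a, c = .two) := by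
  induction a with
  | nil => simp [offset]
  | cons c a ih =>
    obtain ⟨h0, h1, h2, h3⟩ := ih
    have hm : (0 : ℤ) < 2 ^ a.length := by positivity
    simp only [offset, List.length_cons, List.forall_mem_cons, ← h2, ← h3, pow_succ]
    generalize (2 : ℤ) ^ a.length = m at *
    cases c
    · simp only [bit, reduceCtorEq, if_false, mul_zero, zero_add, true_and, false_and, iff_false]
      omega
    · simp only [bit, reduceCtorEq, if_true, mul_one, true_and, false_and, iff_false]
      omega

theorem isCornerOf_points_iff (a : List Code) {x : OBase} (hx : x.IsOpen) (p : ℤ × ℤ) :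
    IsCornerOf p (pointsFrom p (iterUnit a [x])) ↔ IsConst a := by
  have hmem : ∀ q, q ∈ pointsFrom p (iterUnit a [x]) ↔
      InBox (p - entryPt a x.rot) (2 ^ a.length) q := fun q => by
    rw [← mem_points_iterUnit a x hx, sub_add_cancel]
  obtain ⟨h0, h1, h2, h3⟩ := offset_spec a
  have hm : (0 : ℤ) < 2 ^ a.length := by positivity
  rw [IsConst, ← h2, ← h3]
  simp only [IsCornerOf, hmem]
  have he : (entryPt a x.rot).1 ∈ Set.Icc (0 : ℤ) (2 ^ a.length - 1) ∧
      (entryPt a x.rot).2 ∈ Set.Icc (0 : ℤ) (2 ^ a.length - 1) := by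
    simp only [entryPt, entryAt, Set.mem_Icc]
    split_ifs <;> simp <;> omega
  have hcorner : ((entryPt a x.rot).1 = 0 ∨ (entryPt a x.rot).1 = 2 ^ a.length - 1) ∧
      ((entryPt a x.rot).2 = 0 ∨ (entryPt a x.rot).2 = 2 ^ a.length - 1) ↔
      offset a = 0 ∨ offset a = 2 ^ a.length - 1 := by
    simp only [entryPt, entryAt]
    split_ifs <;> simp <;> omega
  rw [← hcorner]
  generalize (2 : ℤ) ^ a.length = m at *
  generalize entryPt a x.rot = v at *
  obtain ⟨⟨a1, a2⟩, b1, b2⟩ := he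
  -- Two opposite corners of the square witness both extreme values of both coordinates.
  have lo : InBox (p - v) m (p - v) := by simp [InBox]; omega
  have hi : InBox (p - v) m (p - v + (m - 1, m - 1)) := by simp [InBox]; omega
  refine and_congr (or_congr ⟨fun h => ?_, fun h q hq => ?_⟩ ⟨fun h => ?_, fun h q hq => ?_⟩)
    (or_congr ⟨fun h => ?_, fun h q hq => ?_⟩ ⟨fun h => ?_, fun h q hq => ?_⟩)
  · have := h _ lo; simp at this; omega
  · simp [InBox] at hq; omega
  · have := h _ hi; simp at this; omega
  · simp [InBox] at hq; omega
  · have := h _ lo; simp at this; omega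
  · simp [InBox] at hq; omega
  · have := h _ hi; simp at this; omega
  · simp [InBox] at hq; omega

theorem cornerInduced_of_path_map {k : ℕ} {P Q : Curve k} {g : Equiv.Perm (ℤ × ℤ)}
    (hg : g ∈ planeMoves) (h : P.path = Q.path.map g) : P.CornerInduced ↔ Q.CornerInduced := by
  simp only [Curve.CornerInduced, h, List.head?_map, Option.map_eq_some_iff, ← List.map_take]
  constructor
  · rintro ⟨_, ⟨p, hp, rfl⟩, hc⟩
    exact ⟨p, hp, (isCornerOf_map hg _ _).1 hc⟩
  · rintro ⟨p, hp, hc⟩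
    exact ⟨g p, ⟨p, hp, rfl⟩, (isCornerOf_map hg _ _).2 hc⟩

theorem cornerInduced_stdCurve {n : ℕ} (e f : Fin 3) (a : List.Vector Code n) :
    (stdCurve e f a).CornerInduced ↔ IsConst a.1 := by
  have hpath : (stdCurve e f a).path = pointsFrom 0 (iterUnit a.1 (stdU e f)) := rfl
  have hhead : (stdCurve e f a).path.head? = some 0 := by
    rw [hpath]
    obtain ⟨y, t, h⟩ := List.exists_cons_of_ne_nil
      (iterUnit_ne_nil a.1 (s := stdU e f) (by simp [stdU]))
    rw [h]; rfl
  have htake : (stdCurve e f a).path.take (4 ^ (n + 1 - 1)) =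
      pointsFrom 0 (iterUnit a.1 [startTile e]) := by
    have h : stdU e f = [startTile e] ++ [⟨.R, 0⟩, ⟨.R, 3⟩, revRefl (startTile f)] := rfl
    rw [hpath, h, iterUnit_append, pointsFrom_append]
    have hl : (pointsFrom 0 (iterUnit a.1 [startTile e])).length = 4 ^ (n + 1 - 1) := by
      have := a.2
      simp [length_pointsFrom, length_iterUnit, this]
    rw [← hl, List.take_left]
  rw [Curve.CornerInduced, hhead, htake, ← isCornerOf_points_iff a.1 (startTile_spec e).1 0]
  simp

/-! ### Counting shapes -/

theorem shape_eq_iff {k : ℕ} {P Q : Curve k} : P.shape = Q.shape ↔ SameShape P Q :=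
  Quotient.eq (r := shapeSetoid k)

/-- The shape of `stdCurve e f a`, which depends on the unordered pair of `e` and `f` only. -/
def shapeOf {n : ℕ} (a : List.Vector Code n) : Sym2 (Fin 3) → Shape (n + 1) :=
  Sym2.lift ⟨fun e f => (stdCurve e f a).shape, fun e f => shape_eq_iff.2 (sameShape_swap e f a)⟩

theorem shapeOf_eq_iff {n : ℕ} (hn : n ≠ 0) {a b : List.Vector Code n} {z w : Sym2 (Fin 3)} :
    shapeOf a z = shapeOf b w ↔ a = b ∧ z.map (entryClass a.1) = w.map (entryClass a.1) := by
  induction z with | _ e f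
  induction w with | _ e' f'
  exact shape_eq_iff.trans (sameShape_iff hn)

theorem mem_cornerShapes_iff {n : ℕ} {S : Shape (n + 1)} :
    S ∈ cornerShapes (n + 1) ↔ ∃ a z, IsConst a.1 ∧ shapeOf a z = S := by
  constructor
  · rintro ⟨P, hP, rfl⟩
    obtain ⟨e, f, a, g, hg, h⟩ := exists_stdCurve P
    refine ⟨a, s(e, f), ?_, shape_eq_iff.2 ⟨g, hg, Or.inl h⟩⟩
    rwa [← cornerInduced_stdCurve e f, ← cornerInduced_of_path_map hg h]
  · rintro ⟨a, z, ha, rfl⟩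
    induction z with | _ e f
    exact ⟨stdCurve e f a, (cornerInduced_stdCurve e f a).2 ha, rfl⟩

theorem mem_sideShapes_iff {n : ℕ} {S : Shape (n + 1)} :
    S ∈ sideShapes (n + 1) ↔ ∃ a z, ¬ IsConst a.1 ∧ shapeOf a z = S := by
  constructor
  · rintro ⟨P, hP, rfl⟩
    obtain ⟨e, f, a, g, hg, h⟩ := exists_stdCurve P
    refine ⟨a, s(e, f), ?_, shape_eq_iff.2 ⟨g, hg, Or.inl h⟩⟩
    rwa [← cornerInduced_stdCurve e f, ← cornerInduced_of_path_map hg h]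
  · rintro ⟨a, z, ha, rfl⟩
    induction z with | _ e f
    exact ⟨stdCurve e f a, fun h => ha ((cornerInduced_stdCurve e f a).1 h), rfl⟩

theorem disjoint_cornerShapes_sideShapes {n : ℕ} (hn : n ≠ 0) :
    Disjoint (cornerShapes (n + 1)) (sideShapes (n + 1)) := by
  rw [Set.disjoint_left]
  intro S h h'
  obtain ⟨a, z, ha, rfl⟩ := mem_cornerShapes_iff.1 h
  obtain ⟨b, w, hb, he⟩ := mem_sideShapes_iff.1 h'
  obtain ⟨rfl, -⟩ := (shapeOf_eq_iff hn).1 he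
  exact hb ha

theorem cornerShapes_union_sideShapes (k : ℕ) : cornerShapes k ∪ sideShapes k = Set.univ := by
  refine Set.eq_univ_of_forall fun S => ?_
  induction S using Quotient.inductionOn with | _ P
  by_cases h : P.CornerInduced
  · exact Or.inl ⟨P, h, rfl⟩
  · exact Or.inr ⟨P, h, rfl⟩

theorem isConst_iff {n : ℕ} (a : List.Vector Code n) :
    IsConst a.1 ↔ ∃ c, a = List.Vector.replicate n c := by
  have h : ∀ c, a = List.Vector.replicate n c ↔ ∀ d ∈ a.1, d = c := fun c => by
    have h' : a.1 = List.replicate n c ↔ ∀ d ∈ a.1, d = c :=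
      List.eq_replicate_iff.trans (and_iff_right a.2)
    exact Subtype.ext_iff.trans h'
  simp only [h, IsConst]
  constructor
  · rintro (h | h)
    exacts [⟨_, h⟩, ⟨_, h⟩]
  · rintro ⟨_ | _, h⟩
    exacts [Or.inl h, Or.inr h]

theorem entryClass_of_not_isConst {a : List Code} (ha : ¬ IsConst a) : entryClass a = id := by
  funext e
  simp only [IsConst, not_or] at ha
  simp only [entryClass, ha, false_and, or_self, if_false, id]

/-- The function `entryClass` for a nonempty list of codes `c`. -/
def constClass (c : Code) (e : Fin 3) : Fin 3 :=
  if c = .one ∧ e = 1 ∨ c = .two ∧ e = 2 then 0 else e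

/-- The two representatives of the entry classes for a nonempty list of codes `c`. -/
def constRep (c : Code) (i : Fin 2) : Fin 3 :=
  match c, i with
  | _, 0 => 0
  | .one, 1 => 2
  | .two, 1 => 1

theorem entryClass_replicate {n : ℕ} (hn : n ≠ 0) (c : Code) :
    entryClass (List.Vector.replicate n c).1 = constClass c := by
  funext e
  have h : ∀ d, (∀ x ∈ (List.Vector.replicate n c).1, x = d) ↔ c = d := fun d => by
    change (∀ x ∈ List.replicate n c, x = d) ↔ c = d
    simp [List.mem_replicate, hn]
  simp only [entryClass, constClass, h]

theorem map_constRep_injective : ∀ (c : Code) (z w : Sym2 (Fin 2)),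
    (z.map (constRep c)).map (constClass c) = (w.map (constRep c)).map (constClass c) → z = w := by
  decide +kernel

theorem exists_map_constRep : ∀ (c : Code) (z : Sym2 (Fin 3)), ∃ w : Sym2 (Fin 2),
    (w.map (constRep c)).map (constClass c) = z.map (constClass c) := by
  decide +kernel

theorem ncard_cornerShapes {n : ℕ} (hn : n ≠ 0) : (cornerShapes (n + 1)).ncard = 6 := by
  let F : Code × Sym2 (Fin 2) → Shape (n + 1) :=
    fun p => shapeOf (List.Vector.replicate n p.1) (p.2.map (constRep p.1))
  have hF : Function.Injective F := by
    rintro ⟨c, z⟩ ⟨d, w⟩ h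
    obtain ⟨h1, h2⟩ := (shapeOf_eq_iff hn).1 h
    have hcd : c = d := by
      have h3 : List.replicate n c = List.replicate n d := congrArg Subtype.val h1
      simpa [hn] using h3
    subst hcd
    rw [entryClass_replicate hn] at h2
    rw [map_constRep_injective c z w h2]
  have hr : cornerShapes (n + 1) = Set.range F := by
    ext S
    rw [mem_cornerShapes_iff]
    constructor
    · rintro ⟨a, z, ha, rfl⟩
      obtain ⟨c, rfl⟩ := (isConst_iff a).1 ha
      obtain ⟨w, hw⟩ := exists_map_constRep c z
      exact ⟨(c, w), (shapeOf_eq_iff hn).2 ⟨rfl, by rwa [entryClass_replicate hn]⟩⟩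
    · rintro ⟨⟨c, w⟩, rfl⟩
      exact ⟨_, _, (isConst_iff _).2 ⟨c, rfl⟩, rfl⟩
  rw [hr, ← Set.image_univ, Set.ncard_image_of_injective _ hF, Set.ncard_univ,
    Nat.card_eq_fintype_card]
  decide +kernel

theorem card_not_isConst {n : ℕ} (hn : n ≠ 0) :
    Nat.card {a : List.Vector Code n // ¬ IsConst a.1} = 2 ^ n - 2 := by
  have hinj : Function.Injective fun c : Code => List.Vector.replicate n c := by
    intro c d h
    have h3 : List.replicate n c = List.replicate n d := congrArg Subtype.val h
    simpa [hn] using h3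
  have hset : {a : List.Vector Code n | ¬ IsConst a.1} =
      (Set.range fun c : Code => List.Vector.replicate n c)ᶜ := by
    ext a
    simp [isConst_iff, eq_comm]
  have hcode : Fintype.card Code = 2 := rfl
  change Nat.card ↥{a : List.Vector Code n | ¬ IsConst a.1} = _
  rw [Nat.card_coe_set_eq, hset, Set.ncard_compl, ← Set.image_univ,
    Set.ncard_image_of_injective _ hinj, Set.ncard_univ, Nat.card_eq_fintype_card,
    Nat.card_eq_fintype_card, card_vector, hcode]

theorem ncard_sideShapes {n : ℕ} (hn : n ≠ 0) :
    (sideShapes (n + 1)).ncard = 6 * (2 ^ n - 2) := by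
  let F : {a : List.Vector Code n // ¬ IsConst a.1} × Sym2 (Fin 3) → Shape (n + 1) :=
    fun p => shapeOf p.1.1 p.2
  have hF : Function.Injective F := by
    rintro ⟨⟨a, ha⟩, z⟩ ⟨⟨b, hb⟩, w⟩ h
    obtain ⟨h1, h2⟩ := (shapeOf_eq_iff hn).1 h
    change a = b at h1
    change Sym2.map (entryClass a.1) z = Sym2.map (entryClass a.1) w at h2
    subst h1
    rw [entryClass_of_not_isConst ha, Sym2.map_id] at h2
    simpa using h2
  have hr : sideShapes (n + 1) = Set.range F := by
    ext S
    rw [mem_sideShapes_iff]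
    constructor
    · rintro ⟨a, z, ha, rfl⟩
      exact ⟨(⟨a, ha⟩, z), rfl⟩
    · rintro ⟨⟨⟨a, ha⟩, w⟩, rfl⟩
      exact ⟨_, _, ha, rfl⟩
  have h6 : Nat.card (Sym2 (Fin 3)) = 6 := by
    rw [Nat.card_eq_fintype_card]; decide +kernel
  rw [hr, ← Set.image_univ, Set.ncard_image_of_injective _ hF, Set.ncard_univ, Nat.card_prod,
    card_not_isConst hn, h6, mul_comm]

theorem card_shape {n : ℕ} (hn : n ≠ 0) : Nat.card (Shape (n + 1)) = 6 + 6 * (2 ^ n - 2) := by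
  have hfin : (Set.univ : Set (Shape (n + 1))).Finite := by
    have : (Set.univ : Set (Shape (n + 1))) =
        Set.range fun p : List.Vector Code n × Sym2 (Fin 3) => shapeOf p.1 p.2 := by
      rw [← cornerShapes_union_sideShapes]
      ext S
      rw [Set.mem_union, mem_cornerShapes_iff, mem_sideShapes_iff]
      constructor
      · rintro (⟨a, z, -, rfl⟩ | ⟨a, z, -, rfl⟩)
        exacts [⟨(a, z), rfl⟩, ⟨(a, z), rfl⟩]
      · rintro ⟨⟨a, z⟩, rfl⟩
        by_cases ha : IsConst a.1
        exacts [Or.inl ⟨a, z, ha, rfl⟩, Or.inr ⟨a, z, ha, rfl⟩]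
    rw [this]
    exact Set.finite_range _
  rw [← Set.ncard_univ, ← cornerShapes_union_sideShapes, Set.ncard_union_eq
    (disjoint_cornerShapes_sideShapes hn) (hfin.subset (Set.subset_univ _))
    (hfin.subset (Set.subset_univ _)), ncard_cornerShapes hn, ncard_sideShapes hn]

theorem card_shape_zero : Nat.card (Shape 0) = 1 := by
  rw [Nat.card_eq_one_iff_unique]
  refine ⟨⟨fun S T => ?_⟩, ⟨Curve.shape ⟨[⟨.I, 0⟩], ⟨.I, 0⟩, [], rfl, rfl⟩⟩⟩
  induction S using Quotient.inductionOn with | _ P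
  induction T using Quotient.inductionOn with | _ Q
  have h : ∀ P : Curve 0, P.path = [0] := fun P => by
    obtain ⟨x, a, ha, hP⟩ := P.exists_iterUnit
    obtain rfl := List.length_eq_zero_iff.1 ha
    rw [Curve.path, hP]; rfl
  exact shape_eq_iff.2 ⟨1, one_mem _, Or.inl (by simp [h])⟩

theorem card_shape_one : Nat.card (Shape 1) = 1 := by
  rw [Nat.card_eq_one_iff_unique]
  have key : ∀ P : Curve 1, P.shape = (stdCurve 0 0 List.Vector.nil).shape := fun P => by
    obtain ⟨e, f, a, g, hg, h⟩ := exists_stdCurve P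
    refine (shape_eq_iff.2 ⟨g, hg, Or.inl ?_⟩).symm
    have hp : ∀ e f, pointsFrom 0 (stdU e f) = pointsFrom 0 (stdU 0 0) := by decide +kernel
    obtain rfl := a.eq_nil
    rw [h]
    exact congrArg _ (hp e f)
  refine ⟨⟨fun S T => ?_⟩, ⟨(stdCurve 0 0 List.Vector.nil).shape⟩⟩
  induction S using Quotient.inductionOn with | _ P
  induction T using Quotient.inductionOn with | _ Q
  exact (key P).trans (key Q).symm

end TwoByTwo

theorem mainTheorem9 :
    (∀ k : ℕ, k ≤ 1 → Nat.card (TwoByTwo.Shape k) = 1) ∧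
    (∀ k : ℕ, 2 ≤ k →
      Nat.card (TwoByTwo.Shape k) = 6 + 6 * (2 ^ (k - 1) - 2) ∧
      Nat.card (TwoByTwo.Shape k) = 6 * 2 ^ (k - 1) - 6 ∧
      (TwoByTwo.cornerShapes k).ncard = 6 ∧
      (TwoByTwo.sideShapes k).ncard = 6 * (2 ^ (k - 1) - 2) ∧
      Disjoint (TwoByTwo.cornerShapes k) (TwoByTwo.sideShapes k) ∧
      TwoByTwo.cornerShapes k ∪ TwoByTwo.sideShapes k = Set.univ) := by
  refine ⟨fun k hk => ?_, fun k hk => ?_⟩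
  · interval_cases k
    exacts [TwoByTwo.card_shape_zero, TwoByTwo.card_shape_one]
  · obtain ⟨n, rfl⟩ : ∃ n, k = n + 1 := ⟨k - 1, by omega⟩
    have hn : n ≠ 0 := by omega
    have h2 : 2 ≤ 2 ^ n := Nat.le_self_pow hn 2
    have hc := TwoByTwo.card_shape hn
    refine ⟨hc, ?_, TwoByTwo.ncard_cornerShapes hn, TwoByTwo.ncard_sideShapes hn,
      TwoByTwo.disjoint_cornerShapes_sideShapes hn, TwoByTwo.cornerShapes_union_sideShapes _⟩
    rw [hc, Nat.add_sub_cancel]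
    omega
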